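/- **Setting.** Let $y\in\mathbb R^n$ be targets, let every sample $i\in\{1,\dots,n\}$ belong to one group $a_i$ of a finite set $A$ (the combinations of protected attributes), and let $\phi:\mathbb R\to[0,1]$ be a relevance function. For $t\in[0,1]$ and $\alpha\in A$ put $D_t^\alpha=\{i:\ a_i=\alpha,\ \phi(y_i)\ge t\}$ and, for predictions $\hat y\in\mathbb R^n$ and $D_t^\alpha\neq\emptyset$, $e_t^\alpha(\hat y)=\frac1{|D_t^\alpha|}\sum_{i\in D_t^\alpha}(\hat y_i-y_i)^2$. Let $A_t=\{\alpha: D_t^\alpha\ne\emptyset\}$ and let $\alpha_{\min}=\alpha_{\min}(t,\hat y)\in\arg\min_{\alpha\in A_t}e_t^\alpha(\hat y)$, where ties are broken by an arbitrary fixed rule that picks one element of every nonempty set of groups. Define $$\mathrm{IDLoss}(\hat y)=\int_0^1\sum_{\alpha\in A_t\setminus\{\alpha_{\min}\}}e_t^\alpha(\hat y)\,dt,\qquad (\nabla\mathrm{IDLoss}(\hat y))_j=\int_0^1\sum_{\alpha\in A_t\setminus\{\alpha_{\min}\},\ j\in D_t^\alpha}\frac{2(\hat y_j-y_j)}{|D_t^\alpha|}\,dt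 .$$ A number $\theta\in[0,1)$ is a *Łojasiewicz exponent* of $\mathrm{IDLoss}$ if every $p$ with $\nabla\mathrm{IDLoss}(p)=0$ has a neighbourhood on which $|\mathrm{IDLoss}(x)-\mathrm{IDLoss}(p)|^\theta\le c\,\|\nabla\mathrm{IDLoss}(x)\|$ for some constant $c>0$. **Theorem.** For all such data the following hold. 1. Wherever $\mathrm{IDLoss}$ is differentiable, its gradient is the vector $\nabla\mathrm{IDLoss}$ above. 2. Every $\theta\in[1/2,1)$ is a Łojasiewicz exponent of $\mathrm{IDLoss}$. 3. (Iterations.) There is $\eta_0>0$ such that for every constant step size $\eta\in(0,\eta_0]$, every starting point $\hat y^{(0)}\in\mathbb R^n$ and every $\theta\in[0,1)$ with $\theta\neq 1/2$ (in particular, every Łojasiewicz exponent $\theta\ne1/2$ of $\mathrm{IDLoss}$), there is a constant $C>0$ such that for every $\varepsilon>0$ gradient descent $\hat y^{(k+1)}=\hat y^{(k)}-\eta\nabla\mathrm{IDLoss}(\hat y^{(k)})$ reaches an iterate with $\|\nabla\mathrm{IDLoss}(\hat y^{(k)})\|\le\varepsilon$ for some $k\le C\,\varepsilon^{-2/|1-2\theta|}$.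 (For $\theta<1/2$ this is $O(\varepsilon^{-2/(1-2\theta)})$.) 4. (Cost of a gradient evaluation.) There is an absolute constant $C$ such that for all $n$, $A$, all assignments of the samples to the groups, all tie-breaking rules and every ordering of the samples there is a computation tree over the reals (arithmetic operations, rational constants and comparisons, each of cost one) which, on input $\hat y$, $y$ and the relevances $(\phi(y_i))_i$, computes $\nabla\mathrm{IDLoss}(\hat y)$ with at most $C\,n\,|A|$ operations, for all inputs whose relevances are nondecreasing in that ordering. (The ordering does not depend on $\hat y$, so it is found once, before the optimization.) -/

import Mathlib

/-! ### The loss -/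

/-- The data that enter the loss: `n` samples with targets `y i` and protected-attribute
combinations `group i`, the set `A` of all combinations, and a relevance function with values
in `[0, 1]`. -/
structure FairData (n : ℕ) (A : Type*) where
  y : Fin n → ℝ
  group : Fin n → A
  φ : ℝ → ℝ
  φ_mem : ∀ v, φ v ∈ Set.Icc (0 : ℝ) 1

/-- A rule that picks one element of every nonempty set of groups; it decides which minimizer
is called `α_min` when several groups have the same minimal error. -/
structure TieBreak (A : Type*) where
  pick : Finset A → A
  pick_mem : ∀ s : Finset A, s.Nonempty → pick s ∈ s

namespace FairData

variable {n : ℕ} {A : Type*} [Fintype A] [DecidableEq A]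

/-- The relevance of the `i`-th sample. -/
def relevance (D : FairData n A) (i : Fin n) : ℝ := D.φ (D.y i)

/-- `D_t^α`: the samples of group `α` whose relevance is at least `t`. -/
noncomputable def cell (D : FairData n A) (t : ℝ) (α : A) : Finset (Fin n) :=
  Finset.univ.filter (fun i => t ≤ D.relevance i ∧ D.group i = α)

/-- `SER_t^α / |D_t^α|`: the mean squared error of the predictions `x` over `D_t^α`. -/
noncomputable def err (D : FairData n A) (x : EuclideanSpace ℝ (Fin n)) (t : ℝ) (α : A) : ℝ :=
  (∑ i ∈ D.cell t α, (x i - D.y i) ^ 2) / ((D.cell t α).card : ℝ)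

/-- The groups with at least one sample of relevance at least `t`, that is, those for which the
mean error at level `t` makes sense. -/
noncomputable def active (D : FairData n A) (t : ℝ) : Finset A :=
  Finset.univ.filter (fun α => (D.cell t α).Nonempty)

/-- The groups of minimal mean error at level `t`. -/
noncomputable def minimizers (D : FairData n A) (x : EuclideanSpace ℝ (Fin n)) (t : ℝ) :
    Finset A :=
  (D.active t).filter (fun α => ∀ β ∈ D.active t, D.err x t α ≤ D.err x t β)

/-- `α_min` at level `t`. -/
noncomputable def alphaMin (D : FairData n A) (τ : TieBreak A) (x : EuclideanSpace ℝ (Fin n))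
    (t : ℝ) : A :=
  τ.pick (D.minimizers x t)

/-- `IDLoss`, as a function of the vector of predictions. -/
noncomputable def idLoss (D : FairData n A) (τ : TieBreak A) (x : EuclideanSpace ℝ (Fin n)) : ℝ :=
  ∫ t in (0 : ℝ)..1, ∑ α ∈ (D.active t).erase (D.alphaMin τ x t), D.err x t α

/-- The gradient of `IDLoss`: the vector of the derivatives with respect to the predictions,
taken under the integral with `α_min` held fixed. -/
noncomputable def idGrad (D : FairData n A) (τ : TieBreak A) (x : EuclideanSpace ℝ (Fin n)) :
    EuclideanSpace ℝ (Fin n) :=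
  WithLp.toLp 2 (fun j =>
    ∫ t in (0 : ℝ)..1, ∑ α ∈ (D.active t).erase (D.alphaMin τ x t),
      if j ∈ D.cell t α then 2 * (x j - D.y j) / ((D.cell t α).card : ℝ) else 0)

end FairData

/-! ### Gradient descent and the Łojasiewicz inequality -/

/-- Gradient descent along the gradient field `G` with constant step size `η`, from `x₀`. -/
noncomputable def gradDescent {E : Type*} [AddCommGroup E] [Module ℝ E] (G : E → E) (η : ℝ)
    (x₀ : E) : ℕ → E
  | 0 => x₀
  | k + 1 => gradDescent G η x₀ k - η • G (gradDescent G η x₀ k)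

/-- `θ` is a Łojasiewicz exponent of `f`, with gradient field `G`: every critical point `p` has a
neighbourhood on which `|f x - f p| ^ θ ≤ c * ‖G x‖` for some constant `c > 0`. -/
def IsLojasiewiczExponent {E : Type*} [NormedAddCommGroup E] (f : E → ℝ) (G : E → E) (θ : ℝ) :
    Prop :=
  0 ≤ θ ∧ θ < 1 ∧
    ∀ p, G p = 0 → ∃ c > 0, ∀ᶠ x in nhds p, |f x - f p| ^ θ ≤ c * ‖G x‖

/-! ### Operation counts: computation trees over the reals -/

/-- The arithmetic operations. -/
inductive ArithOp
  | add
  | sub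
  | mul
  | div

/-- The value of an arithmetic operation. -/
noncomputable def ArithOp.eval : ArithOp → ℝ → ℝ → ℝ
  | add, a, b => a + b
  | sub, a, b => a - b
  | mul, a, b => a * b
  | div, a, b => a / b

/-- Computation trees with read-only input cells indexed by `ι`, work cells indexed by `ℕ`, and
one output for every element of `o`. A node loads a rational constant, performs one arithmetic
operation, or compares two cells; a leaf names the cells that hold the outputs. -/
inductive CompTree (ι o : Type) : Type
  | leaf (out : o → ι ⊕ ℕ) : CompTree ι o
  | const (dst : ℕ) (q : ℚ) (next : CompTree ι o) : CompTree ι o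
  | arith (op : ArithOp) (dst : ℕ) (a b : ι ⊕ ℕ) (next : CompTree ι o) : CompTree ι o
  | branch (a b : ι ⊕ ℕ) (ifLe ifGt : CompTree ι o) : CompTree ι o

namespace CompTree

variable {ι o : Type}

/-- The outputs of a tree on the input `inp`, started with work cells `w`. -/
noncomputable def run (inp : ι → ℝ) : CompTree ι o → (ℕ → ℝ) → o → ℝ
  | leaf out, w => fun k => Sum.elim inp w (out k)
  | const dst q next, w => run inp next (Function.update w dst (q : ℝ))
  | arith op dst a b next, w =>
      run inp next (Function.update w dst (op.eval (Sum.elim inp w a) (Sum.elim inp w b)))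
  | branch a b ifLe ifGt, w =>
      if Sum.elim inp w a ≤ Sum.elim inp w b then run inp ifLe w else run inp ifGt w

/-- The number of operations (constants, arithmetic operations, comparisons) that are performed
on the input `inp`, started with work cells `w`. -/
noncomputable def cost (inp : ι → ℝ) : CompTree ι o → (ℕ → ℝ) → ℕ
  | leaf _, _ => 0
  | const dst q next, w => cost inp next (Function.update w dst (q : ℝ)) + 1
  | arith op dst a b next, w =>
      cost inp next (Function.update w dst (op.eval (Sum.elim inp w a) (Sum.elim inp w b))) + 1
  | branch a b ifLe ifGt, w =>
      (if Sum.elim inp w a ≤ Sum.elim inp w b then cost inp ifLe w else cost inp ifGt w) + 1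

end CompTree

/-- The real input of a gradient evaluation: predictions, targets and relevances. -/
def FairData.input {n : ℕ} {A : Type*} (D : FairData n A) (x : EuclideanSpace ℝ (Fin n)) :
    Fin n ⊕ Fin n ⊕ Fin n → ℝ :=
  Sum.elim (fun i => x i) (Sum.elim D.y D.relevance)

/-! Let the knots be the sorted relevances together with 0 and 1. Between consecutive knots the sets
$D_t^\alpha$ do not change, so the integral is a finite sum and $\mathrm{IDLoss}(x)=\sum_j
w_j(x)(x_j-y_j)^2$, with gradient field $2w_j(x)(x_j-y_j)$ (`idLoss_eq`, `idGrad_apply`). The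
weights lie in $[0,1]$. They depend on $x$ only through the excluded group at each level, so they
take finitely many values.

Gradient: dropping a minimal error leaves the largest possible sum. Each level is therefore a
maximum of convex quadratics, and `idGrad` is a global subgradient (`idLoss_add_inner_idGrad_le`).
At a point of differentiability a subgradient is the gradient.

Łojasiewicz: nonzero weights are bounded below by some $m>0$, hence $\mathrm{IDLoss}\le
K^2\|\nabla\mathrm{IDLoss}\|^2$ everywhere and critical values are 0. This gives $\theta=1/2$; local
boundedness of the loss gives larger $\theta$.

Iterations: the gradient field may jump at ties, so the decreasing quantity is $\|x-y\|^2$ instead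
of the loss. It makes $\sum_k\|\nabla\mathrm{IDLoss}(\hat y^{(k)})\|^2$ finite, so
$O(\varepsilon^{-2})$ steps suffice. No Łojasiewicz inequality enters, since $2/|1-2\theta|\ge2$.

Cost: squared errors per group are suffix sums along the ordering, and gradient coefficients per
group are prefix sums. Each of the $O(n|A|)$ entries takes boundedly many operations. -/

namespace FairData

/-! ### Reduction of the integral to finitely many levels -/

variable {n : ℕ} {A : Type*}

/-- The samples of relevance at least `t`. -/
noncomputable def upper (D : FairData n A) (t : ℝ) : Finset (Fin n) :=
  Finset.univ.filter (fun i => t ≤ D.relevance i)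

/-- The samples at position at least `k` in the ordering `σ`. -/
def tail (σ : Equiv.Perm (Fin n)) (k : ℕ) : Finset (Fin n) :=
  Finset.univ.filter (fun i => k ≤ (σ.symm i : ℕ))

@[simp] theorem mem_tail {σ : Equiv.Perm (Fin n)} {k : ℕ} {i : Fin n} :
    i ∈ tail σ k ↔ k ≤ (σ.symm i : ℕ) := by simp [tail]

/-- The relevances in the ordering `σ`, preceded by `0` and followed by `1`. -/
noncomputable def knot (D : FairData n A) (σ : Equiv.Perm (Fin n)) : ℕ → ℝ
  | 0 => 0
  | k + 1 => if h : k < n then D.relevance (σ ⟨k, h⟩) else 1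

theorem knot_mono (D : FairData n A) {σ : Equiv.Perm (Fin n)}
    (hσ : Monotone (fun i => D.relevance (σ i))) : Monotone (D.knot σ) := by
  refine monotone_nat_of_le_succ fun k => ?_
  cases k with
  | zero =>
    simp only [knot]
    split_ifs
    · exact (D.φ_mem _).1
    · exact zero_le_one
  | succ k =>
    simp only [knot]
    split_ifs with h₁ h₂
    · exact hσ (by simp [Fin.le_def])
    · exact (D.φ_mem _).2
    · omega
    · exact le_rfl

theorem knot_sub_nonneg (D : FairData n A) {σ : Equiv.Perm (Fin n)}
    (hσ : Monotone (fun i => D.relevance (σ i))) (k : ℕ) :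
    0 ≤ D.knot σ (k + 1) - D.knot σ k :=
  sub_nonneg.2 (D.knot_mono hσ k.le_succ)

/-- The interval is closed on the right because membership in `upper` is $t\le$ relevance. Tied
relevances give empty intervals and do no harm. -/
theorem upper_eq_tail (D : FairData n A) {σ : Equiv.Perm (Fin n)}
    (hσ : Monotone (fun i => D.relevance (σ i))) {k : ℕ} {t : ℝ}
    (ht : t ∈ Set.Ioc (D.knot σ k) (D.knot σ (k + 1))) : D.upper t = tail σ k := by
  ext i
  obtain ⟨l, rfl⟩ := σ.surjective i
  have hl : D.knot σ (l + 1) = D.relevance (σ l) := by simp [knot]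
  simp only [upper, Finset.mem_filter, Finset.mem_univ, true_and, mem_tail,
    Equiv.symm_apply_apply]
  rw [← hl]
  constructor
  · intro h
    by_contra hk
    exact absurd (h.trans (D.knot_mono hσ (show (l : ℕ) + 1 ≤ k by omega))) (not_le.2 ht.1)
  · intro h
    exact ht.2.trans (D.knot_mono hσ (by omega))

/-- There are $n+1$ intervals. Above the largest relevance no sample is left, and `h0` removes that
last term. -/
theorem integral_upper (D : FairData n A) {σ : Equiv.Perm (Fin n)}
    (hσ : Monotone (fun i => D.relevance (σ i))) (Φ : Finset (Fin n) → ℝ) (h0 : Φ ∅ = 0) :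
    ∫ t in (0 : ℝ)..1, Φ (D.upper t) =
      ∑ k ∈ Finset.range n, (D.knot σ (k + 1) - D.knot σ k) * Φ (tail σ k) := by
  have hle : ∀ k, D.knot σ k ≤ D.knot σ (k + 1) := fun k => D.knot_mono hσ k.le_succ
  have hcongr : ∀ k, Set.EqOn (fun t => Φ (D.upper t)) (fun _ => Φ (tail σ k))
      (Set.uIoc (D.knot σ k) (D.knot σ (k + 1))) := by
    intro k t ht
    rw [Set.uIoc_of_le (hle k)] at ht
    simp only [D.upper_eq_tail hσ ht]
  have hsum := intervalIntegral.sum_integral_adjacent_intervals (μ := MeasureTheory.volume)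
    (f := fun t => Φ (D.upper t)) (a := D.knot σ) (n := n + 1)
    (fun k _ => (intervalIntegrable_congr (hcongr k)).2 intervalIntegrable_const)
  have hend : D.knot σ (n + 1) = 1 := by simp [knot]
  have htail : tail σ n = ∅ := by
    ext i
    simp
  rw [hend, show D.knot σ 0 = 0 from rfl] at hsum
  rw [← hsum, Finset.sum_congr rfl fun k _ => intervalIntegral.integral_congr_ae
      (Filter.Eventually.of_forall (hcongr k)),
    Finset.sum_range_succ]
  simp [htail, h0]

/-- The minimizers of `e` over `T`. -/
noncomputable def argminSet (T : Finset A) (e : A → ℝ) : Finset A :=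
  T.filter (fun α => ∀ β ∈ T, e α ≤ e β)

theorem mem_argminSet {T : Finset A} {e : A → ℝ} {α : A} :
    α ∈ argminSet T e ↔ α ∈ T ∧ ∀ β ∈ T, e α ≤ e β := Finset.mem_filter

theorem argminSet_nonempty {T : Finset A} (hT : T.Nonempty) (e : A → ℝ) :
    (argminSet T e).Nonempty := by
  obtain ⟨a, ha, h⟩ := T.exists_min_image e hT
  exact ⟨a, mem_argminSet.2 ⟨ha, h⟩⟩

/-! ### The loss as a weighted sum of squares -/

variable [DecidableEq A]

/-- The mean squared error over the samples of `U` in group `α`. -/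
noncomputable def blockErr (D : FairData n A) (x : EuclideanSpace ℝ (Fin n))
    (U : Finset (Fin n)) (α : A) : ℝ :=
  (∑ i ∈ U.filter (fun i => D.group i = α), (x i - D.y i) ^ 2) /
    ((U.filter (fun i => D.group i = α)).card : ℝ)

/-- The chosen group of minimal mean squared error over `U`. -/
noncomputable def blockMin (D : FairData n A) (τ : TieBreak A) (x : EuclideanSpace ℝ (Fin n))
    (U : Finset (Fin n)) : A :=
  τ.pick (argminSet (U.image D.group) (D.blockErr x U))

/-- The coefficient of the `j`-th squared error in the sum of the mean squared errors over `U` of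
all groups but `β`. -/
noncomputable def coef (grp : Fin n → A) (β : A) (U : Finset (Fin n)) (j : Fin n) : ℝ :=
  if j ∈ U ∧ grp j ≠ β then 1 / ((U.filter (fun i => grp i = grp j)).card : ℝ) else 0

theorem coef_nonneg (grp : Fin n → A) (β : A) (U : Finset (Fin n)) (j : Fin n) :
    0 ≤ coef grp β U j := by
  unfold coef
  split_ifs <;> positivity

theorem coef_le_one (grp : Fin n → A) (β : A) (U : Finset (Fin n)) (j : Fin n) :
    coef grp β U j ≤ 1 := by
  unfold coef
  split_ifs with h
  · have : 1 ≤ (U.filter (fun i => grp i = grp j)).card :=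
      Finset.card_pos.2 ⟨j, by simp [h.1]⟩
    rw [div_le_one (by exact_mod_cast this)]
    exact_mod_cast this
  · exact zero_le_one

theorem cell_eq (D : FairData n A) (t : ℝ) (α : A) :
    D.cell t α = (D.upper t).filter (fun i => D.group i = α) := by
  ext i
  simp [cell, upper]

theorem err_eq (D : FairData n A) (x : EuclideanSpace ℝ (Fin n)) (t : ℝ) :
    D.err x t = D.blockErr x (D.upper t) := by
  funext α
  simp [err, blockErr, cell_eq]

theorem sum_erase_blockErr (D : FairData n A) (x : EuclideanSpace ℝ (Fin n))
    (U : Finset (Fin n)) (β : A) :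
    ∑ α ∈ (U.image D.group).erase β, D.blockErr x U α =
      ∑ j, coef D.group β U j * (x j - D.y j) ^ 2 := by
  have h1 : ∑ j, coef D.group β U j * (x j - D.y j) ^ 2 =
      ∑ j ∈ U.filter (fun j => D.group j ≠ β), coef D.group β U j * (x j - D.y j) ^ 2 := by
    symm
    apply Finset.sum_subset (Finset.subset_univ _)
    intro j _ hj
    rw [Finset.mem_filter] at hj
    rw [coef, if_neg hj, zero_mul]
  rw [h1, ← Finset.sum_fiberwise_of_maps_to (g := D.group) (t := (U.image D.group).erase β)]
  · refine Finset.sum_congr rfl fun α hα => ?_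
    have hαβ : α ≠ β := (Finset.mem_erase.1 hα).1
    have hfilter : (U.filter (fun j => D.group j ≠ β)).filter (fun j => D.group j = α) =
        U.filter (fun j => D.group j = α) := by
      ext j
      simp only [Finset.mem_filter]
      constructor
      · exact fun h => ⟨h.1.1, h.2⟩
      · exact fun h => ⟨⟨h.1, h.2 ▸ hαβ⟩, h.2⟩
    rw [hfilter, blockErr, Finset.sum_div]
    refine Finset.sum_congr rfl fun j hj => ?_
    obtain ⟨hjU, rfl⟩ := Finset.mem_filter.1 hj
    rw [coef, if_pos ⟨hjU, hαβ⟩]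
    ring
  · intro j hj
    obtain ⟨hjU, hjβ⟩ := Finset.mem_filter.1 hj
    exact Finset.mem_erase.2 ⟨hjβ, Finset.mem_image_of_mem _ hjU⟩

theorem sum_erase_ite (D : FairData n A) (x : EuclideanSpace ℝ (Fin n))
    (U : Finset (Fin n)) (β : A) (j : Fin n) :
    (∑ α ∈ (U.image D.group).erase β,
      if j ∈ U.filter (fun i => D.group i = α) then
        2 * (x j - D.y j) / ((U.filter (fun i => D.group i = α)).card : ℝ) else 0) =
      2 * (x j - D.y j) * coef D.group β U j := by
  by_cases h : j ∈ U ∧ D.group j ≠ β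
  · rw [Finset.sum_eq_single (D.group j), coef, if_pos h, if_pos (by simp [h.1]), mul_one_div]
    · intro α _ hα
      rw [if_neg]
      exact fun h => hα (Finset.mem_filter.1 h).2.symm
    · exact fun h' => absurd (Finset.mem_erase.2 ⟨h.2, Finset.mem_image_of_mem _ h.1⟩) h'
  · rw [coef, if_neg h, mul_zero]
    refine Finset.sum_eq_zero fun α hα => if_neg fun hj => h ?_
    obtain ⟨hjU, rfl⟩ := Finset.mem_filter.1 hj
    exact ⟨hjU, (Finset.mem_erase.1 hα).1⟩

/-- Both sides are the total error minus that of one group, and `blockMin` subtracts the least. -/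
theorem sum_coef_le_sum_coef_blockMin (D : FairData n A) (τ : TieBreak A)
    (z : EuclideanSpace ℝ (Fin n)) {U : Finset (Fin n)} {β : A} (hβ : β ∈ U.image D.group) :
    ∑ j, coef D.group β U j * (z j - D.y j) ^ 2 ≤
      ∑ j, coef D.group (D.blockMin τ z U) U j * (z j - D.y j) ^ 2 := by
  have hmem : D.blockMin τ z U ∈ argminSet (U.image D.group) (D.blockErr z U) :=
    τ.pick_mem _ (argminSet_nonempty ⟨β, hβ⟩ _)
  obtain ⟨h₁, h₂⟩ := mem_argminSet.1 hmem
  rw [← sum_erase_blockErr, ← sum_erase_blockErr]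
  have e₁ := Finset.add_sum_erase _ (D.blockErr z U) hβ
  have e₂ := Finset.add_sum_erase _ (D.blockErr z U) h₁
  linarith [h₂ β hβ]

/-- The coefficient of the `j`-th squared error in the loss at `x`. -/
noncomputable def weight (D : FairData n A) (τ : TieBreak A) (σ : Equiv.Perm (Fin n))
    (x : EuclideanSpace ℝ (Fin n)) (j : Fin n) : ℝ :=
  ∑ k ∈ Finset.range n, (D.knot σ (k + 1) - D.knot σ k) *
    coef D.group (D.blockMin τ x (tail σ k)) (tail σ k) j

theorem weight_nonneg (D : FairData n A) (τ : TieBreak A) {σ : Equiv.Perm (Fin n)}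
    (hσ : Monotone (fun i => D.relevance (σ i))) (x : EuclideanSpace ℝ (Fin n)) (j : Fin n) :
    0 ≤ D.weight τ σ x j :=
  Finset.sum_nonneg fun k _ => mul_nonneg (D.knot_sub_nonneg hσ k) (coef_nonneg ..)

theorem weight_le_one (D : FairData n A) (τ : TieBreak A) {σ : Equiv.Perm (Fin n)}
    (hσ : Monotone (fun i => D.relevance (σ i))) (x : EuclideanSpace ℝ (Fin n)) (j : Fin n) :
    D.weight τ σ x j ≤ 1 := by
  calc D.weight τ σ x j ≤ ∑ k ∈ Finset.range n, (D.knot σ (k + 1) - D.knot σ k) :=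
        Finset.sum_le_sum fun k _ =>
          mul_le_of_le_one_right (D.knot_sub_nonneg hσ k) (coef_le_one ..)
    _ = D.knot σ n := by rw [Finset.sum_range_sub]; simp [knot]
    _ ≤ D.knot σ (n + 1) := D.knot_mono hσ n.le_succ
    _ = 1 := by simp [knot]

/-- The point $x$ enters a weight only through the pattern of excluded groups, and there are
finitely many patterns. The least nonzero value serves as $m$. -/
theorem exists_weight_gap [Finite A] (D : FairData n A) (τ : TieBreak A) {σ : Equiv.Perm (Fin n)}
    (hσ : Monotone (fun i => D.relevance (σ i))) :
    ∃ m > 0, ∀ x j, D.weight τ σ x j ≠ 0 → m ≤ D.weight τ σ x j := by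
  have hfin : (Set.range fun p : EuclideanSpace ℝ (Fin n) × Fin n =>
      D.weight τ σ p.1 p.2).Finite := by
    refine (Set.finite_range fun q : (Fin n → A) × Fin n => ∑ k : Fin n,
      (D.knot σ (k + 1) - D.knot σ k) * coef D.group (q.1 k) (tail σ k) q.2).subset ?_
    rintro _ ⟨⟨x, j⟩, rfl⟩
    exact ⟨⟨fun k => D.blockMin τ x (tail σ k), j⟩, by simp only [weight, Finset.sum_range]⟩
  have hpos : (Set.range (fun p : EuclideanSpace ℝ (Fin n) × Fin n =>
      D.weight τ σ p.1 p.2) \ {0}).Finite := hfin.subset Set.sdiff_subset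
  by_cases hne : (Set.range (fun p : EuclideanSpace ℝ (Fin n) × Fin n =>
      D.weight τ σ p.1 p.2) \ {0}).Nonempty
  · obtain ⟨m, ⟨⟨p, rfl⟩, hm0⟩, hm⟩ := Set.exists_min_image _ id hpos hne
    exact ⟨_, (D.weight_nonneg τ hσ p.1 p.2).lt_of_ne' hm0,
      fun x j h => hm _ ⟨⟨⟨x, j⟩, rfl⟩, h⟩⟩
  · refine ⟨1, one_pos, fun x j h => absurd ⟨D.weight τ σ x j, ⟨⟨x, j⟩, rfl⟩, h⟩ hne⟩

variable [Fintype A]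

theorem active_eq (D : FairData n A) (t : ℝ) : D.active t = (D.upper t).image D.group := by
  ext α
  simp [active, cell_eq, Finset.Nonempty]

theorem alphaMin_eq (D : FairData n A) (τ : TieBreak A) (x : EuclideanSpace ℝ (Fin n)) (t : ℝ) :
    D.alphaMin τ x t = D.blockMin τ x (D.upper t) := by
  simp only [alphaMin, blockMin, minimizers, argminSet, active_eq, err_eq]
  congr!

theorem idLoss_eq_sum_range (D : FairData n A) (τ : TieBreak A) {σ : Equiv.Perm (Fin n)}
    (hσ : Monotone (fun i => D.relevance (σ i))) (x : EuclideanSpace ℝ (Fin n)) :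
    D.idLoss τ x = ∑ k ∈ Finset.range n, (D.knot σ (k + 1) - D.knot σ k) *
      ∑ j, coef D.group (D.blockMin τ x (tail σ k)) (tail σ k) j * (x j - D.y j) ^ 2 := by
  rw [← D.integral_upper hσ
    (fun U => ∑ j, coef D.group (D.blockMin τ x U) U j * (x j - D.y j) ^ 2) (by simp [coef])]
  simp only [idLoss, active_eq, err_eq, alphaMin_eq, sum_erase_blockErr]

theorem idLoss_eq (D : FairData n A) (τ : TieBreak A) {σ : Equiv.Perm (Fin n)}
    (hσ : Monotone (fun i => D.relevance (σ i))) (x : EuclideanSpace ℝ (Fin n)) :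
    D.idLoss τ x = ∑ j, D.weight τ σ x j * (x j - D.y j) ^ 2 := by
  simp only [D.idLoss_eq_sum_range τ hσ, weight, Finset.mul_sum, Finset.sum_mul]
  rw [Finset.sum_comm]
  simp only [mul_assoc]

theorem idGrad_apply (D : FairData n A) (τ : TieBreak A) {σ : Equiv.Perm (Fin n)}
    (hσ : Monotone (fun i => D.relevance (σ i))) (x : EuclideanSpace ℝ (Fin n)) (j : Fin n) :
    D.idGrad τ x j = 2 * (x j - D.y j) * D.weight τ σ x j := by
  have := D.integral_upper hσ
    (fun U => 2 * (x j - D.y j) * coef D.group (D.blockMin τ x U) U j) (by simp [coef])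
  simp only [idGrad, active_eq, alphaMin_eq, cell_eq, sum_erase_ite, this, weight,
    Finset.mul_sum]
  exact Finset.sum_congr rfl fun k _ => by ring

/-! ### The subgradient inequality -/

/-- At each level, freeze the group excluded at $x$. The frozen sum is a convex quadratic lying
above its tangent at $x$ and below the true level sum at $z$. -/
theorem idLoss_add_inner_idGrad_le (D : FairData n A) (τ : TieBreak A)
    (x z : EuclideanSpace ℝ (Fin n)) :
    D.idLoss τ x + inner ℝ (D.idGrad τ x) (z - x) ≤ D.idLoss τ z := by
  have hσ := Tuple.monotone_sort D.relevance
  set σ := Tuple.sort D.relevance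
  replace hσ : Monotone (fun i => D.relevance (σ i)) := hσ
  have hinner : inner ℝ (D.idGrad τ x) (z - x) =
      ∑ k ∈ Finset.range n, (D.knot σ (k + 1) - D.knot σ k) *
        ∑ j, coef D.group (D.blockMin τ x (tail σ k)) (tail σ k) j *
          (2 * (x j - D.y j) * (z j - x j)) := by
    simp only [PiLp.inner_apply, D.idGrad_apply τ hσ, weight, Finset.mul_sum]
    rw [Finset.sum_comm]
    simp only [PiLp.sub_apply, RCLike.inner_apply, conj_trivial, Finset.mul_sum]
    refine Finset.sum_congr rfl fun k _ => Finset.sum_congr rfl fun j _ => ?_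
    ring
  rw [hinner, D.idLoss_eq_sum_range τ hσ, D.idLoss_eq_sum_range τ hσ, ← Finset.sum_add_distrib]
  refine Finset.sum_le_sum fun k hk => ?_
  rw [← mul_add, ← Finset.sum_add_distrib]
  refine mul_le_mul_of_nonneg_left ?_ (D.knot_sub_nonneg hσ k)
  have hne : (tail σ k).Nonempty := ⟨σ ⟨k, Finset.mem_range.1 hk⟩, by simp⟩
  have hmem : D.blockMin τ x (tail σ k) ∈ argminSet ((tail σ k).image D.group) _ :=
    τ.pick_mem _ (argminSet_nonempty (hne.image D.group) _)
  have hβ := (mem_argminSet.1 hmem).1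
  refine le_trans (Finset.sum_le_sum fun j _ => ?_) (D.sum_coef_le_sum_coef_blockMin τ z hβ)
  rw [← mul_add]
  refine mul_le_mul_of_nonneg_left ?_ (coef_nonneg ..)
  nlinarith [sq_nonneg (z j - x j)]

theorem hasGradientAt_idLoss (D : FairData n A) (τ : TieBreak A) (x : EuclideanSpace ℝ (Fin n))
    (hx : DifferentiableAt ℝ (D.idLoss τ) x) : HasGradientAt (D.idLoss τ) (D.idGrad τ x) x := by
  have hd := hx.hasFDerivAt.fun_sub (innerSL ℝ (D.idGrad τ x)).hasFDerivAt
  -- By the subgradient inequality $x$ is even a global minimum, so the derivative of the difference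
  -- vanishes there.
  have hmin : IsLocalMin (fun z => D.idLoss τ z - innerSL ℝ (D.idGrad τ x) z) x := by
    refine Filter.Eventually.of_forall fun z => ?_
    have := D.idLoss_add_inner_idGrad_le τ x z
    rw [inner_sub_right] at this
    simp only [innerSL_apply_apply]
    linarith
  have h0 := hmin.hasFDerivAt_eq_zero hd
  rw [hasGradientAt_iff_hasFDerivAt]
  have : (InnerProductSpace.toDual ℝ (EuclideanSpace ℝ (Fin n))) (D.idGrad τ x) =
      fderiv ℝ (D.idLoss τ) x := (sub_eq_zero.1 h0).symm
  rw [this]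
  exact hx.hasFDerivAt

/-! ### The Łojasiewicz inequality -/

theorem idLoss_nonneg (D : FairData n A) (τ : TieBreak A) (x : EuclideanSpace ℝ (Fin n)) :
    0 ≤ D.idLoss τ x := by
  have hσ : Monotone (fun i => D.relevance (Tuple.sort D.relevance i)) :=
    Tuple.monotone_sort D.relevance
  rw [D.idLoss_eq τ hσ]
  exact Finset.sum_nonneg fun j _ => mul_nonneg (D.weight_nonneg τ hσ x j) (sq_nonneg _)

theorem sq_norm_idGrad (D : FairData n A) (τ : TieBreak A) {σ : Equiv.Perm (Fin n)}
    (hσ : Monotone (fun i => D.relevance (σ i))) (x : EuclideanSpace ℝ (Fin n)) :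
    ‖D.idGrad τ x‖ ^ 2 = ∑ j, (2 * (x j - D.y j) * D.weight τ σ x j) ^ 2 := by
  simp only [EuclideanSpace.norm_sq_eq, D.idGrad_apply τ hσ, Real.norm_eq_abs, sq_abs]

/-- Coordinatewise, $w\ge m$ gives $w r^2\le w^2r^2/m\le(2rw)^2/m$, and coordinates with $w=0$
contribute nothing to either side. -/
theorem exists_idLoss_le_mul_sq_norm_idGrad (D : FairData n A) (τ : TieBreak A) :
    ∃ K > 0, ∀ x, D.idLoss τ x ≤ K ^ 2 * ‖D.idGrad τ x‖ ^ 2 := by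
  have hσ : Monotone (fun i => D.relevance (Tuple.sort D.relevance i)) :=
    Tuple.monotone_sort D.relevance
  obtain ⟨m, hm, h⟩ := D.exists_weight_gap τ hσ
  refine ⟨√(1 / m), by positivity, fun x => ?_⟩
  rw [Real.sq_sqrt (by positivity), D.idLoss_eq τ hσ, D.sq_norm_idGrad τ hσ, Finset.mul_sum]
  refine Finset.sum_le_sum fun j _ => ?_
  rcases eq_or_ne (D.weight τ (Tuple.sort D.relevance) x j) 0 with h0 | h0
  · simp [h0]
  · have hw := h x j h0
    rw [div_mul_eq_mul_div, le_div_iff₀ hm]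
    have hw0 := hm.le.trans hw
    have := mul_le_mul_of_nonneg_left hw (mul_nonneg hw0 (sq_nonneg (x j - D.y j)))
    nlinarith [sq_nonneg ((x j - D.y j) * D.weight τ (Tuple.sort D.relevance) x j)]

theorem idLoss_le_sq_norm (D : FairData n A) (τ : TieBreak A) (x : EuclideanSpace ℝ (Fin n)) :
    D.idLoss τ x ≤ ‖x - WithLp.toLp 2 D.y‖ ^ 2 := by
  have hσ : Monotone (fun i => D.relevance (Tuple.sort D.relevance i)) :=
    Tuple.monotone_sort D.relevance
  rw [D.idLoss_eq τ hσ, EuclideanSpace.norm_sq_eq]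
  refine Finset.sum_le_sum fun j _ => ?_
  simpa using mul_le_of_le_one_left (sq_nonneg (x j - D.y j)) (D.weight_le_one τ hσ x j)

theorem idLoss_eq_zero_of_idGrad_eq_zero (D : FairData n A) (τ : TieBreak A)
    {p : EuclideanSpace ℝ (Fin n)} (hp : D.idGrad τ p = 0) : D.idLoss τ p = 0 := by
  obtain ⟨K, -, h⟩ := D.exists_idLoss_le_mul_sq_norm_idGrad τ
  have := h p
  rw [hp] at this
  exact le_antisymm (by simpa using this) (D.idLoss_nonneg τ p)

theorem isLojasiewiczExponent_idLoss (D : FairData n A) (τ : TieBreak A) {θ : ℝ}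
    (h₁ : 1 / 2 ≤ θ) (h₂ : θ < 1) : IsLojasiewiczExponent (D.idLoss τ) (D.idGrad τ) θ := by
  refine ⟨by linarith, h₂, fun p hp => ?_⟩
  obtain ⟨K, hK, h⟩ := D.exists_idLoss_le_mul_sq_norm_idGrad τ
  have hcont : Continuous fun x : EuclideanSpace ℝ (Fin n) => ‖x - WithLp.toLp 2 D.y‖ ^ 2 := by
    fun_prop
  set B := ‖p - WithLp.toLp 2 D.y‖ ^ 2 + 1
  have hB : 0 < B := by positivity
  refine ⟨B ^ (θ - 1 / 2) * K, by positivity, ?_⟩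
  filter_upwards [hcont.continuousAt.eventually_lt_const (lt_add_one _)] with x hx
  rw [D.idLoss_eq_zero_of_idGrad_eq_zero τ hp, sub_zero, abs_of_nonneg (D.idLoss_nonneg τ x)]
  have hxB : D.idLoss τ x ≤ B := (D.idLoss_le_sq_norm τ x).trans hx.le
  have hx0 := D.idLoss_nonneg τ x
  -- The factor with exponent $\theta-1/2$ is bounded by $B^{\theta-1/2}$, the square root by
  -- $K\|\nabla\mathrm{IDLoss}\|$.
  rw [show θ = (θ - 1 / 2) + 1 / 2 by ring, Real.rpow_add_of_nonneg hx0 (by linarith)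
    (by norm_num), mul_assoc, add_sub_cancel_right]
  refine mul_le_mul (Real.rpow_le_rpow hx0 hxB (by linarith)) ?_ (by positivity) (by positivity)
  rw [← Real.sqrt_eq_rpow]
  refine Real.sqrt_le_iff.2 ⟨by positivity, ?_⟩
  rw [mul_pow]
  exact h x

/-! ### Gradient descent -/

/-- A step multiplies the $j$-th residual by $1-2\eta w_j$, whatever pattern of minimizers is in
force. -/
theorem sq_norm_idGrad_le_of_step (D : FairData n A) (τ : TieBreak A) {η : ℝ} (h0 : 0 < η)
    (h1 : η ≤ 1 / 2) (x : EuclideanSpace ℝ (Fin n)) :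
    ‖x - η • D.idGrad τ x - WithLp.toLp 2 D.y‖ ^ 2 + η / 2 * ‖D.idGrad τ x‖ ^ 2 ≤
      ‖x - WithLp.toLp 2 D.y‖ ^ 2 := by
  have hσ : Monotone (fun i => D.relevance (Tuple.sort D.relevance i)) :=
    Tuple.monotone_sort D.relevance
  rw [D.sq_norm_idGrad τ hσ, EuclideanSpace.norm_sq_eq, EuclideanSpace.norm_sq_eq,
    Finset.mul_sum, ← Finset.sum_add_distrib]
  refine Finset.sum_le_sum fun j _ => ?_
  simp only [PiLp.sub_apply, PiLp.smul_apply, D.idGrad_apply τ hσ, smul_eq_mul,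
    Real.norm_eq_abs, sq_abs]
  have hw0 := D.weight_nonneg τ hσ x j
  have hw1 := D.weight_le_one τ hσ x j
  set w := D.weight τ (Tuple.sort D.relevance) x j
  -- The defect is $4\eta w(1-w)+2\eta w^2(1-2\eta)$; the second term is where $\eta\le1/2$ is
  -- needed.
  have key : (1 - 2 * η * w) ^ 2 + 2 * η * w ^ 2 ≤ 1 := by
    have : 0 ≤ η * w * (1 - w) := by
      have := sub_nonneg.2 hw1
      positivity
    have : 0 ≤ η * w * (w * (1 - 2 * η)) := by
      have : 0 ≤ 1 - 2 * η := by linarith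
      positivity
    nlinarith [mul_nonneg h0.le hw0]
  calc _ = ((1 - 2 * η * w) ^ 2 + 2 * η * w ^ 2) * (x j - D.y j) ^ 2 := by ring
    _ ≤ _ := mul_le_of_le_one_left (sq_nonneg _) key

theorem sum_sq_norm_idGrad_le (D : FairData n A) (τ : TieBreak A) {η : ℝ} (h0 : 0 < η)
    (h1 : η ≤ 1 / 2) (x₀ : EuclideanSpace ℝ (Fin n)) (K : ℕ) :
    ‖gradDescent (D.idGrad τ) η x₀ K - WithLp.toLp 2 D.y‖ ^ 2 +
      η / 2 * ∑ k ∈ Finset.range K, ‖D.idGrad τ (gradDescent (D.idGrad τ) η x₀ k)‖ ^ 2 ≤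
        ‖x₀ - WithLp.toLp 2 D.y‖ ^ 2 := by
  induction K with
  | zero => simp [gradDescent]
  | succ K ih =>
    rw [Finset.sum_range_succ, gradDescent]
    linarith [D.sq_norm_idGrad_le_of_step τ h0 h1 (gradDescent (D.idGrad τ) η x₀ K)]

theorem exists_gradDescent_norm_le (D : FairData n A) (τ : TieBreak A) {η : ℝ} (h0 : 0 < η)
    (h1 : η ≤ 1 / 2) (x₀ : EuclideanSpace ℝ (Fin n)) {q : ℝ} (hq : 2 ≤ q) :
    ∃ C : ℝ, 0 < C ∧ ∀ ε : ℝ, 0 < ε → ∃ k : ℕ, (k : ℝ) ≤ C * ε ^ (-q) ∧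
      ‖D.idGrad τ (gradDescent (D.idGrad τ) η x₀ k)‖ ≤ ε := by
  set R := ‖x₀ - WithLp.toLp 2 D.y‖ ^ 2 with hR
  set g := ‖D.idGrad τ x₀‖ with hg
  -- Summed descent bounds (number of steps) $\cdot\,\varepsilon^2$ by $2R/\eta$. The factor
  -- $g^{q-2}$ trades $\varepsilon^{-2}$ for $\varepsilon^{-q}$ when $\varepsilon<g$; if
  -- $\varepsilon\ge g$, the starting point already works. The summand 1 makes the contradiction
  -- strict.
  refine ⟨2 / η * R * g ^ (q - 2) + 1, by positivity, fun ε hε => ?_⟩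
  set C := 2 / η * R * g ^ (q - 2) + 1 with hC
  by_contra! hcon
  have hεg : ε < g := hcon 0 (by simp only [Nat.cast_zero]; positivity)
  set K := ⌊C * ε ^ (-q)⌋₊
  have hK : C * ε ^ (-q) < (K + 1 : ℕ) := by
    push_cast
    exact Nat.lt_floor_add_one _
  have hsum : ((K + 1 : ℕ) : ℝ) * ε ^ 2 ≤
      ∑ k ∈ Finset.range (K + 1), ‖D.idGrad τ (gradDescent (D.idGrad τ) η x₀ k)‖ ^ 2 := by
    rw [← nsmul_eq_mul, ← Finset.card_range (K + 1)]
    simp only [Finset.card_range]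
    refine (by simp : (K + 1) • ε ^ 2 = ∑ k ∈ Finset.range (K + 1), ε ^ 2).trans_le
      (Finset.sum_le_sum fun k hk => ?_)
    refine pow_le_pow_left₀ hε.le (hcon k ?_).le 2
    exact (Nat.le_floor_iff (by positivity)).1 (Nat.lt_succ_iff.1 (Finset.mem_range.1 hk))
  have hdesc := D.sum_sq_norm_idGrad_le τ h0 h1 x₀ (K + 1)
  have hb : C * ε ^ (-q) * ε ^ 2 ≤ 2 / η * R := by
    have h2 : C * ε ^ (-q) * ε ^ 2 ≤ ((K + 1 : ℕ) : ℝ) * ε ^ 2 := by gcongr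
    have h3 : η / 2 * (C * ε ^ (-q) * ε ^ 2) ≤ R := by
      refine le_trans ?_ (le_trans (le_add_of_nonneg_left (sq_nonneg _)) hdesc)
      exact mul_le_mul_of_nonneg_left (h2.trans hsum) (by positivity)
    rw [div_mul_eq_mul_div, le_div_iff₀ h0]
    linarith
  have hpow : ε ^ (-q) * ε ^ 2 = (ε ^ (q - 2))⁻¹ := by
    rw [← Real.rpow_natCast, ← Real.rpow_add hε, ← Real.rpow_neg hε.le]
    congr 1
    push_cast
    ring
  have hpos : 0 < ε ^ (q - 2) := by positivity
  rw [mul_assoc, hpow, ← div_eq_mul_inv, div_le_iff₀ hpos] at hb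
  have hmono : ε ^ (q - 2) ≤ g ^ (q - 2) := Real.rpow_le_rpow hε.le hεg.le (by linarith)
  have : 2 / η * R * ε ^ (q - 2) ≤ 2 / η * R * g ^ (q - 2) := by gcongr
  linarith

end FairData

/-! ### Constructing computation trees -/

namespace CompTree

open FairData

variable {Ω : Type*} {ι o : Type} {inp : Ω → ι → ℝ} {out : Ω → o → ℝ}
  {S S' : Set Ω} {V V' W W' : Set (Ω → ℝ)} {c c' d d' : ℕ} {f g : Ω → ℝ}

/-- From cells that hold the values of the functions in `V`, a tree computes `out` on the inputs
`inp s` with `s ∈ S`, with at most `c` operations. -/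
def Solvable (inp : Ω → ι → ℝ) (out : Ω → o → ℝ) (S : Set Ω) (V : Set (Ω → ℝ)) (c : ℕ) : Prop :=
  ∀ (N : ℕ) (loc : (Ω → ℝ) → ι ⊕ ℕ), (∀ v ∈ V, ∀ m, loc v = Sum.inr m → m < N) →
    ∃ P : CompTree ι o, ∀ s ∈ S, ∀ w : ℕ → ℝ,
      (∀ v ∈ V, Sum.elim (inp s) w (loc v) = v s) →
        P.run (inp s) w = out s ∧ P.cost (inp s) w ≤ c

theorem Solvable.mono (h : Solvable inp out S V c) (hS : S' ⊆ S) (hV : V ⊆ V') (hc : c ≤ c') :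
    Solvable inp out S' V' c' := by
  intro N loc hloc
  obtain ⟨P, hP⟩ := h N loc fun v hv => hloc v (hV hv)
  exact ⟨P, fun s hs w hw => (hP s (hS hs) w fun v hv => hw v (hV hv)).imp_right (·.trans hc)⟩

theorem Solvable.empty : Solvable inp out ∅ V c :=
  fun _ _ _ => ⟨.leaf fun _ => Sum.inr 0, fun _ hs => hs.elim⟩

theorem Solvable.exists_tree
    (h : Solvable inp out S (Set.range fun (i : ι) (s : Ω) => inp s i) c) :
    ∃ P : CompTree ι o, ∀ s ∈ S,
      P.run (inp s) (fun _ => 0) = out s ∧ P.cost (inp s) (fun _ => 0) ≤ c := by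
  classical
  obtain ⟨P, hP⟩ := h 0
    (fun v => if hv : v ∈ Set.range fun i s => inp s i then Sum.inl hv.choose else Sum.inr 0) (by
      intro v hv m hm
      rw [dif_pos hv] at hm
      cases hm)
  refine ⟨P, fun s hs => hP s hs _ fun v hv => ?_⟩
  rw [dif_pos hv]
  exact congrFun hv.choose_spec s

theorem Solvable.leaf (h : ∀ k, ∃ v ∈ V, ∀ s ∈ S, v s = out s k) : Solvable inp out S V c := by
  intro N loc _
  choose v hvV hv using h
  refine ⟨.leaf fun k => loc (v k), fun s hs w hw => ⟨?_, Nat.zero_le _⟩⟩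
  funext k
  exact (hw _ (hvV k)).trans (hv k s hs)

-- The result goes to the fresh cell `N`, beyond all cells in use, so no stored value is
-- overwritten.
open Classical in
theorem Solvable.store (h : Solvable inp out S (insert f V) c)
    (hf : ∀ loc : (Ω → ℝ) → ι ⊕ ℕ, ∃ node : ℕ → CompTree ι o → CompTree ι o,
      ∀ N P, ∀ s ∈ S, ∀ w : ℕ → ℝ, (∀ v ∈ V, Sum.elim (inp s) w (loc v) = v s) →
        (node N P).run (inp s) w = P.run (inp s) (Function.update w N (f s)) ∧
        (node N P).cost (inp s) w = P.cost (inp s) (Function.update w N (f s)) + 1) :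
    Solvable inp out S V (c + 1) := by
  intro N loc hloc
  obtain ⟨node, hnode⟩ := hf loc
  obtain ⟨P, hP⟩ := h (N + 1) (Function.update loc f (Sum.inr N)) (by
    intro v hv m hm
    rcases eq_or_ne v f with rfl | hne
    · rw [Function.update_self] at hm
      cases hm
      exact Nat.lt_succ_self _
    · rw [Function.update_of_ne hne] at hm
      exact (hloc v (hv.resolve_left hne) m hm).trans (Nat.lt_succ_self _))
  refine ⟨node N P, fun s hs w hw => ?_⟩
  obtain ⟨h₁, h₂⟩ := hnode N P s hs w hw
  rw [h₁, h₂]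
  refine (hP s hs _ fun v hv => ?_).imp_right fun h => Nat.succ_le_succ h
  rcases eq_or_ne v f with rfl | hne
  · simp
  · have hvV := hv.resolve_left hne
    rw [Function.update_of_ne hne, ← hw v hvV]
    rcases hl : loc v with i | m
    · rfl
    · simp [Function.update_of_ne (hloc v hvV m hl).ne]

theorem Solvable.const (q : ℚ) (h : Solvable inp out S (insert (fun _ => (q : ℝ)) V) c) :
    Solvable inp out S V (c + 1) :=
  h.store fun _ => ⟨fun N P => .const N q P, fun _ _ _ _ _ _ => ⟨rfl, rfl⟩⟩

theorem Solvable.arith (op : ArithOp) (hf : f ∈ V) (hg : g ∈ V)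
    (h : Solvable inp out S (insert (fun s => op.eval (f s) (g s)) V) c) :
    Solvable inp out S V (c + 1) :=
  h.store fun loc => ⟨fun N P => .arith op N (loc f) (loc g) P, fun N P s _ w hw => by
    simp only [run, cost, hw f hf, hw g hg, and_self]⟩

theorem Solvable.branch (hf : f ∈ V) (hg : g ∈ V)
    (h₁ : Solvable inp out (S ∩ {s | f s ≤ g s}) V c)
    (h₂ : Solvable inp out (S ∩ {s | g s < f s}) V c) : Solvable inp out S V (c + 1) := by
  intro N loc hloc
  obtain ⟨P, hP⟩ := h₁ N loc hloc
  obtain ⟨Q, hQ⟩ := h₂ N loc hloc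
  refine ⟨.branch (loc f) (loc g) P Q, fun s hs w hw => ?_⟩
  simp only [run, cost, hw f hf, hw g hg]
  split_ifs with h
  · exact (hP s ⟨hs, h⟩ w hw).imp_right fun h => Nat.succ_le_succ h
  · exact (hQ s ⟨hs, not_le.1 h⟩ w hw).imp_right fun h => Nat.succ_le_succ h

/-- From the functions in `V`, those in `W` are computed with at most `d` operations. -/
def Provides (inp : Ω → ι → ℝ) (out : Ω → o → ℝ) (V : Set (Ω → ℝ)) (d : ℕ) (W : Set (Ω → ℝ)) :
    Prop :=
  ∀ (S : Set Ω) (V' : Set (Ω → ℝ)) (c : ℕ), V ⊆ V' →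
    Solvable inp out S (V' ∪ W) c → Solvable inp out S V' (c + d)

theorem Provides.mono (h : Provides inp out V d W) (hV : V ⊆ V') (hd : d ≤ d') :
    Provides inp out V' d' W :=
  fun S U c hU hW => (h S U c (hV.trans hU) hW).mono subset_rfl subset_rfl (by omega)

theorem Provides.of_subset (h : W ⊆ V) : Provides inp out V d W :=
  fun S U c hU hW => hW.mono subset_rfl (Set.union_subset subset_rfl (h.trans hU)) (by omega)

theorem Provides.of_mem (h : f ∈ V) : Provides inp out V d {f} :=
  .of_subset (Set.singleton_subset_iff.2 h)

theorem Provides.union (h : Provides inp out V d W) (h' : Provides inp out (V ∪ W) d' W') :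
    Provides inp out V (d + d') (W ∪ W') := by
  intro S U c hU hs
  rw [← Set.union_assoc] at hs
  exact (h S U _ hU (h' S _ c (Set.union_subset_union_left _ hU) hs)).mono subset_rfl subset_rfl
    (by omega)

theorem Provides.const (q : ℚ) : Provides inp out V 1 {fun _ => (q : ℝ)} :=
  fun S U c _ hs => .const q (by rwa [Set.union_singleton] at hs)

theorem Provides.arith (op : ArithOp) (hf : Provides inp out V d {f})
    (hg : Provides inp out V d' {g}) :
    Provides inp out V (d + d' + 1) {fun s => op.eval (f s) (g s)} := by
  intro S U c hU hs
  have h₁ : Solvable inp out S (U ∪ {f} ∪ {g}) (c + 1) :=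
    .arith op (f := f) (g := g) (by simp) (by simp)
      (hs.mono subset_rfl (by intro v; simp; tauto) le_rfl)
  exact (hf S U _ hU (hg S _ _ (hU.trans Set.subset_union_left) h₁)).mono subset_rfl subset_rfl
    (by omega)

theorem Provides.add (hf : Provides inp out V d {f}) (hg : Provides inp out V d' {g}) :
    Provides inp out V (d + d' + 1) {fun s => f s + g s} :=
  .arith .add hf hg

theorem Provides.sub (hf : Provides inp out V d {f}) (hg : Provides inp out V d' {g}) :
    Provides inp out V (d + d' + 1) {fun s => f s - g s} :=
  .arith .sub hf hg

theorem Provides.mul (hf : Provides inp out V d {f}) (hg : Provides inp out V d' {g}) :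
    Provides inp out V (d + d' + 1) {fun s => f s * g s} :=
  .arith .mul hf hg

theorem Provides.div (hf : Provides inp out V d {f}) (hg : Provides inp out V d' {g}) :
    Provides inp out V (d + d' + 1) {fun s => f s / g s} :=
  .arith .div hf hg

theorem Provides.range {I : Type*} [Fintype I] {F : I → Ω → ℝ}
    (h : ∀ i, Provides inp out V d {F i}) :
    Provides inp out V (Fintype.card I * d) (Set.range F) := by
  classical
  have key : ∀ s : Finset I, Provides inp out V (s.card * d) (F '' s) := by
    intro s
    induction s using Finset.induction_on with
    | empty => exact .of_subset (by simp)
    | insert a s ha ih =>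
      rw [Finset.card_insert_of_notMem ha, Nat.succ_mul, Finset.coe_insert, Set.image_insert_eq,
        ← Set.union_singleton]
      exact ih.union ((h a).mono Set.subset_union_left le_rfl)
  simpa using key Finset.univ

/-- Dynamic programming: each family may be computed from all earlier ones. -/
theorem Provides.iUnion_lt {F : ℕ → Set (Ω → ℝ)} (m : ℕ)
    (h : ∀ k < m, Provides inp out (V ∪ ⋃ l < k, F l) d (F k)) :
    Provides inp out V (m * d) (⋃ k < m, F k) := by
  induction m with
  | zero => exact .of_subset (by simp)
  | succ m ih =>
    rw [Nat.succ_mul, Set.biUnion_lt_succ]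
    exact (ih fun k hk => h k (by omega)).union (h m (by omega))

/-- The full set of minimizers is needed because the tie-breaking rule acts on it. It is recorded by
the branch of the tree and uses no cell. A new element is compared with one current minimizer, and
two comparisons separate less, equal and greater. The tree may be large, but only one path is paid
for. -/
theorem Solvable.argmin {A : Type*} [DecidableEq A] {e : A → Ω → ℝ} (T : Finset A)
    (he : ∀ α ∈ T, e α ∈ V)
    (h : ∀ M, Solvable inp out (S ∩ {s | argminSet T (fun α => e α s) = M}) V c) :
    Solvable inp out S V (c + T.card * 2) := by
  induction T using Finset.induction_on generalizing c with
  | empty => exact (h ∅).mono (fun s hs => ⟨hs, by simp [argminSet]⟩) subset_rfl (by simp)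
  | insert a T ha ih =>
    have key : Solvable inp out S V (c + 2 + T.card * 2) := by
      refine ih (fun α hα => he α (Finset.mem_insert_of_mem hα)) fun M => ?_
      rcases M.eq_empty_or_nonempty with rfl | ⟨b, hb⟩
      · refine (h {a}).mono (fun s hs => ⟨hs.1, ?_⟩) subset_rfl (by omega)
        have hT : T = ∅ := by
          by_contra hne
          exact (argminSet_nonempty (Finset.nonempty_iff_ne_empty.2 hne) _).ne_empty hs.2
        subst hT
        ext α
        simp +contextual [mem_argminSet]
      · by_cases hbT : b ∈ T
        · have hea := he a (Finset.mem_insert_self a T)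
          have heb := he b (Finset.mem_insert_of_mem hbT)
          have hmin : ∀ s, argminSet T (fun α => e α s) = M → ∀ β ∈ T, e b s ≤ e β s := by
            rintro s rfl
            exact (mem_argminSet.1 hb).2
          refine .branch hea heb (.branch heb hea ?_ ?_) ?_
          · refine (h (insert a M)).mono (fun s hs => ⟨hs.1.1.1, ?_⟩) subset_rfl le_rfl
            have hbs := hmin s hs.1.1.2
            obtain ⟨⟨⟨-, rfl⟩, hab⟩, hba⟩ := hs
            simp only [Set.mem_ofPred_eq] at *
            ext α
            simp only [mem_argminSet, Finset.mem_insert]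
            grind
          · refine (h {a}).mono (fun s hs => ⟨hs.1.1.1, ?_⟩) subset_rfl le_rfl
            have hbs := hmin s hs.1.1.2
            obtain ⟨⟨⟨-, rfl⟩, -⟩, hab⟩ := hs
            simp only [Set.mem_ofPred_eq] at *
            ext α
            simp only [mem_argminSet, Finset.mem_insert, Finset.mem_singleton]
            grind
          · refine (h M).mono (fun s hs => ⟨hs.1.1, ?_⟩) subset_rfl (by omega)
            have hbs := hmin s hs.1.2
            obtain ⟨⟨-, rfl⟩, hba⟩ := hs
            simp only [Set.mem_ofPred_eq] at *
            ext α
            simp only [mem_argminSet, Finset.mem_insert]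
            grind
        -- A set of minimizers lies in `T`, so this branch is never reached.
        · refine (Solvable.empty (V := V)).mono ?_ subset_rfl le_rfl
          rintro s ⟨-, rfl⟩
          exact hbT (mem_argminSet.1 hb).1
    exact key.mono subset_rfl subset_rfl (by rw [Finset.card_insert_of_notMem ha]; omega)

/-- After the branching the pattern `p` is fixed along each path, so constants that depend on it can
be built into the tree. -/
theorem Solvable.pattern {A : Type*} [Nonempty A] {F : ℕ → Ω → A} (m : ℕ)
    (hF : ∀ k < m, ∀ (S : Set Ω) (c : ℕ),
      (∀ a, Solvable inp out (S ∩ {s | F k s = a}) V c) → Solvable inp out S V (c + d))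
    (h : ∀ p : ℕ → A, Solvable inp out (S ∩ {s | ∀ k < m, F k s = p k}) V c) :
    Solvable inp out S V (c + m * d) := by
  induction m generalizing c with
  | zero =>
    exact (h fun _ => Classical.arbitrary A).mono (fun s hs => ⟨hs, by simp⟩) subset_rfl (by omega)
  | succ m ih =>
    have key : Solvable inp out S V (c + d + m * d) := by
      refine ih (fun k hk => hF k (by omega)) fun p => hF m (by omega) _ _ fun a => ?_
      refine (h (Function.update p m a)).mono ?_ subset_rfl le_rfl
      rintro s ⟨⟨hs, hp⟩, ha⟩
      refine ⟨hs, fun k hk => ?_⟩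
      rcases Nat.lt_succ_iff_lt_or_eq.1 hk with hk | rfl
      · rw [Function.update_of_ne hk.ne, hp k hk]
      · rw [Function.update_self]
        exact ha
    exact key.mono subset_rfl subset_rfl (by rw [Nat.succ_mul]; omega)

end CompTree

/-! ### Computing the gradient -/

namespace FairData

open CompTree

variable {n : ℕ} {A : Type*}

/-- The input of a gradient evaluation, together with the data and the predictions it encodes. -/
abbrev inputOf (s : FairData n A × EuclideanSpace ℝ (Fin n)) : Fin n ⊕ Fin n ⊕ Fin n → ℝ :=
  s.1.input s.2

/-- The functions of the data and the predictions that are given as inputs. -/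
def inputs (n : ℕ) (A : Type*) : Set (FairData n A × EuclideanSpace ℝ (Fin n) → ℝ) :=
  Set.range fun i s => inputOf s i

variable {o : Type} {out : FairData n A × EuclideanSpace ℝ (Fin n) → o → ℝ}
  {V : Set (FairData n A × EuclideanSpace ℝ (Fin n) → ℝ)} {d : ℕ}

theorem provides_input (hV : inputs n A ⊆ V) (i : Fin n ⊕ Fin n ⊕ Fin n) :
    Provides inputOf out V 0 {fun s => inputOf s i} :=
  .of_mem (hV ⟨i, rfl⟩)

theorem provides_residual (hV : inputs n A ⊆ V) (j : Fin n) :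
    Provides inputOf out V 1 {fun s => s.2 j - s.1.y j} :=
  (provides_input hV (.inl j)).sub (provides_input hV (.inr (.inl j)))

theorem provides_knot (hV : inputs n A ⊆ V) (σ : Equiv.Perm (Fin n)) {k : ℕ} (hk : k ≤ n) :
    Provides inputOf out V 1 {fun s => s.1.knot σ k} := by
  cases k with
  | zero => simpa [knot] using (Provides.const 0 : Provides inputOf out V 1 _)
  | succ k =>
    simp only [knot, dif_pos (Nat.lt_of_succ_le hk)]
    exact (provides_input hV (.inr (.inr (σ ⟨k, hk⟩)))).mono subset_rfl zero_le_one

/-! ### Suffix sums of errors and prefix sums of coefficients -/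

variable [DecidableEq A]

/-- The samples of group `α` at position at least `k`. -/
def tailBlock (grp : Fin n → A) (σ : Equiv.Perm (Fin n)) (k : ℕ) (α : A) : Finset (Fin n) :=
  (tail σ k).filter fun i => grp i = α

/-- The sum of the squared errors over `tailBlock grp σ k α`. -/
noncomputable def tailSum (grp : Fin n → A) (σ : Equiv.Perm (Fin n)) (k : ℕ) (α : A)
    (s : FairData n A × EuclideanSpace ℝ (Fin n)) : ℝ :=
  ∑ i ∈ tailBlock grp σ k α, (s.2 i - s.1.y i) ^ 2

/-- The mean squared error over `tailBlock grp σ k α`. -/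
noncomputable def tailErr (grp : Fin n → A) (σ : Equiv.Perm (Fin n)) (k : ℕ) (α : A)
    (s : FairData n A × EuclideanSpace ℝ (Fin n)) : ℝ :=
  tailSum grp σ k α s / (((tailBlock grp σ k α).card : ℚ) : ℝ)

/-- The coefficient of the samples of group `α` that is contributed by the first `m` levels, if
`p k` is the group of minimal error at level `k`. -/
noncomputable def prefixCoef (grp : Fin n → A) (σ : Equiv.Perm (Fin n)) (p : ℕ → A) (m : ℕ) (α : A)
    (s : FairData n A × EuclideanSpace ℝ (Fin n)) : ℝ :=
  ∑ k ∈ Finset.range m, (s.1.knot σ (k + 1) - s.1.knot σ k) *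
    ((if α ≠ p k then 1 / ((tailBlock grp σ k α).card : ℚ) else 0 : ℚ) : ℝ)

theorem tailSum_eq_zero (grp : Fin n → A) (σ : Equiv.Perm (Fin n)) (α : A) :
    tailSum grp σ n α = fun _ => ((0 : ℚ) : ℝ) := by
  have : tail σ n = ∅ := by
    ext i
    simp
  simp [funext_iff, tailSum, tailBlock, this]

theorem tail_eq_insert (σ : Equiv.Perm (Fin n)) {k : ℕ} (hk : k < n) :
    tail σ k = insert (σ ⟨k, hk⟩) (tail σ (k + 1)) := by
  ext i
  rw [Finset.mem_insert, mem_tail, mem_tail, ← Equiv.symm_apply_eq, Fin.ext_iff]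
  simp only
  omega

theorem tailSum_of_ne (grp : Fin n → A) (σ : Equiv.Perm (Fin n)) {k : ℕ} (hk : k < n) {α : A}
    (hα : grp (σ ⟨k, hk⟩) ≠ α) : tailSum grp σ k α = tailSum grp σ (k + 1) α := by
  funext s
  rw [tailSum, tailSum, tailBlock, tail_eq_insert σ hk, Finset.filter_insert, if_neg hα,
    tailBlock]

theorem tailSum_of_eq (grp : Fin n → A) (σ : Equiv.Perm (Fin n)) {k : ℕ} (hk : k < n) {α : A}
    (hα : grp (σ ⟨k, hk⟩) = α) : tailSum grp σ k α = fun s =>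
      (s.2 (σ ⟨k, hk⟩) - s.1.y (σ ⟨k, hk⟩)) * (s.2 (σ ⟨k, hk⟩) - s.1.y (σ ⟨k, hk⟩)) +
        tailSum grp σ (k + 1) α s := by
  funext s
  rw [tailSum, tailSum, tailBlock, tail_eq_insert σ hk, Finset.filter_insert, if_pos hα,
    Finset.sum_insert (by simp), tailBlock, sq]

/-- Sample $j$ belongs only to the levels up to its own position, and its coefficient there depends
only on its group. Hence one table of prefix sums per group serves all samples. -/
theorem weight_eq_prefixCoef (D : FairData n A) (τ : TieBreak A) (σ : Equiv.Perm (Fin n))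
    (x : EuclideanSpace ℝ (Fin n)) {p : ℕ → A}
    (hp : ∀ k < n, D.blockMin τ x (tail σ k) = p k) (j : Fin n) :
    D.weight τ σ x j = prefixCoef D.group σ p ((σ.symm j : ℕ) + 1) (D.group j) (D, x) := by
  rw [weight, prefixCoef, ← Finset.sum_subset
    (Finset.range_subset_range.2 (show (σ.symm j : ℕ) + 1 ≤ n from (σ.symm j).2))]
  · refine Finset.sum_congr rfl fun k hk => ?_
    rw [Finset.mem_range] at hk
    rw [hp k (by omega), coef]
    congr 1
    have hj : j ∈ tail σ k := mem_tail.2 (by omega)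
    by_cases h : D.group j = p k <;> simp [h, hj, tailBlock]
  · intro k _ hk
    rw [coef, if_neg, mul_zero]
    rw [mem_tail, Finset.mem_range] at *
    omega

theorem provides_gradient (hV : inputs n A ⊆ V) {grp : Fin n → A} {σ : Equiv.Perm (Fin n)}
    {p : ℕ → A} (hp : ∀ k ≤ n, ∀ α, prefixCoef grp σ p k α ∈ V) :
    Provides inputOf out V (n * 4) (Set.range fun j s =>
      ((2 : ℚ) : ℝ) * (s.2 j - s.1.y j) * prefixCoef grp σ p ((σ.symm j : ℕ) + 1) (grp j) s) := by
  have := Provides.range (out := out) fun j => ((Provides.const 2).mul (provides_residual hV j)).mul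
    (.of_mem (d := 0) (hp _ (σ.symm j).2 (grp j)))
  rwa [Fintype.card_fin] at this

variable [Fintype A]

/-- The index $n-k$ runs the recursion from the empty tail backwards. An entry costs at most two
subtractions, a product and a sum. -/
theorem provides_tailSum (hV : inputs n A ⊆ V) (grp : Fin n → A) (σ : Equiv.Perm (Fin n)) :
    Provides inputOf out V ((n + 1) * (Fintype.card A * 4))
      (⋃ k < n + 1, Set.range (tailSum grp σ (n - k))) := by
  refine .iUnion_lt (n + 1) fun k hk => .range fun α => ?_
  have hV' : inputs n A ⊆ V ∪ ⋃ l < k, Set.range (tailSum grp σ (n - l)) :=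
    hV.trans Set.subset_union_left
  cases k with
  | zero =>
    rw [Nat.sub_zero, tailSum_eq_zero]
    exact (Provides.const 0).mono subset_rfl (by norm_num)
  | succ k =>
    have hm : n - (k + 1) < n := by omega
    have hprev : tailSum grp σ (n - (k + 1) + 1) α ∈
        V ∪ ⋃ l < k + 1, Set.range (tailSum grp σ (n - l)) := by
      rw [show n - (k + 1) + 1 = n - k by omega]
      exact Or.inr (Set.mem_biUnion (Nat.lt_succ_self k) ⟨α, rfl⟩)
    by_cases hα : grp (σ ⟨n - (k + 1), hm⟩) = α
    · rw [tailSum_of_eq grp σ hm hα]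
      exact ((provides_residual hV' _).mul (provides_residual hV' _)).add
        (.of_mem (d := 0) hprev)
    · rw [tailSum_of_ne grp σ hm hα]
      exact .of_mem hprev

theorem provides_tailErr {grp : Fin n → A} {σ : Equiv.Perm (Fin n)}
    (hV : ∀ k < n, ∀ α, tailSum grp σ k α ∈ V) :
    Provides inputOf out V (n * Fintype.card A * 2)
      (Set.range fun q : Fin n × A => tailErr grp σ q.1 q.2) := by
  rw [show n * Fintype.card A = Fintype.card (Fin n × A) by simp]
  -- Block sizes are constants of the tree, since the grouping and the ordering are fixed. For an
  -- empty block the quotient is the default $0/0=0$; such groups do not take part in the search for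
  -- the minimum.
  exact .range fun q => (Provides.of_mem (d := 0) (hV q.1 q.1.2 q.2)).div (.const _)

theorem provides_prefixCoef (hV : inputs n A ⊆ V) (grp : Fin n → A) (σ : Equiv.Perm (Fin n))
    (p : ℕ → A) : Provides inputOf out V ((n + 1) * (Fintype.card A * 6))
      (⋃ k < n + 1, Set.range (prefixCoef grp σ p k)) := by
  refine .iUnion_lt (n + 1) fun k hk => .range fun α => ?_
  have hV' : inputs n A ⊆ V ∪ ⋃ l < k, Set.range (prefixCoef grp σ p l) :=
    hV.trans Set.subset_union_left
  cases k with
  | zero =>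
    have : prefixCoef grp σ p 0 α = fun _ => ((0 : ℚ) : ℝ) := by
      simp [funext_iff, prefixCoef]
    rw [this]
    exact (Provides.const 0).mono subset_rfl (by norm_num)
  | succ k =>
    have hprev : prefixCoef grp σ p k α ∈ V ∪ ⋃ l < k + 1, Set.range (prefixCoef grp σ p l) :=
      Or.inr (Set.mem_biUnion (Nat.lt_succ_self k) ⟨α, rfl⟩)
    have hsucc : prefixCoef grp σ p (k + 1) α = fun s => prefixCoef grp σ p k α s +
        (s.1.knot σ (k + 1) - s.1.knot σ k) *
          ((if α ≠ p k then 1 / ((tailBlock grp σ k α).card : ℚ) else 0 : ℚ) : ℝ) :=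
      funext fun s => Finset.sum_range_succ _ k
    rw [hsucc]
    exact (Provides.of_mem (d := 0) hprev).add
      (((provides_knot hV' σ (by omega)).sub (provides_knot hV' σ (by omega))).mul (.const _))

theorem exists_gradientTree (τ : TieBreak A) (grp : Fin n → A)
    (σ : Equiv.Perm (Fin n)) :
    ∃ P : CompTree (Fin n ⊕ Fin n ⊕ Fin n) (Fin n),
      ∀ D : FairData n A, D.group = grp → Monotone (fun i => D.relevance (σ i)) →
        ∀ x : EuclideanSpace ℝ (Fin n),
          (∀ j, P.run (D.input x) (fun _ => 0) j = D.idGrad τ x j) ∧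
          P.cost (D.input x) (fun _ => 0) ≤ 28 * (n * Fintype.card A) := by
  -- For $n=0$ the bound allows no operation at all. For $n>0$ both $n$ and $|A|$ are at least 1,
  -- which absorbs the lower-order terms.
  rcases Nat.eq_zero_or_pos n with rfl | hn
  · exact ⟨.leaf fun _ => Sum.inr 0, fun D _ _ x => ⟨fun j => j.elim0, Nat.zero_le _⟩⟩
  have : Nonempty A := ⟨grp ⟨0, hn⟩⟩
  have hA : 0 < Fintype.card A := Fintype.card_pos
  have key : Solvable inputOf (fun s j => s.1.idGrad τ s.2 j)
      {s : FairData n A × EuclideanSpace ℝ (Fin n) |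
        s.1.group = grp ∧ Monotone fun i => s.1.relevance (σ i)} (inputs n A)
      (0 + n * 4 + (n + 1) * (Fintype.card A * 6) + n * (Fintype.card A * 2) +
        n * Fintype.card A * 2 + (n + 1) * (Fintype.card A * 4)) := by
    refine provides_tailSum subset_rfl grp σ _ _ _ subset_rfl ?_
    refine provides_tailErr (grp := grp) (σ := σ) (fun k hk α => Or.inr ?_) _ _ _ subset_rfl ?_
    · refine Set.mem_biUnion (show n - k < n + 1 by omega) ⟨α, ?_⟩
      rw [Nat.sub_sub_self hk.le]
    set V := inputs n A ∪ (⋃ k < n + 1, Set.range (tailSum grp σ (n - k))) ∪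
      Set.range fun q : Fin n × A => tailErr grp σ q.1 q.2
    have hV : inputs n A ⊆ V := Set.subset_union_left.trans Set.subset_union_left
    -- Determine the excluded group at every level, at two comparisons per group and level.
    refine .pattern (F := fun k s =>
      τ.pick (argminSet ((tail σ k).image grp) fun α => tailErr grp σ k α s)) n ?_ ?_
    · intro k hk S c h
      refine Solvable.mono (.argmin (e := tailErr grp σ k) ((tail σ k).image grp)
        (fun α _ => Or.inr ⟨(⟨k, hk⟩, α), rfl⟩)
        fun M => (h (τ.pick M)).mono (fun s hs => ⟨hs.1, ?_⟩) subset_rfl le_rfl)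
        subset_rfl subset_rfl ?_
      · exact congrArg τ.pick hs.2
      · have := Finset.card_le_univ ((tail σ k).image grp)
        omega
    · intro p
      refine provides_prefixCoef hV grp σ p _ _ _ subset_rfl ?_
      have hp : ∀ k ≤ n, ∀ α, prefixCoef grp σ p k α ∈
          V ∪ ⋃ k < n + 1, Set.range (prefixCoef grp σ p k) := fun k hk α =>
        Or.inr (Set.mem_iUnion₂.2 ⟨k, Nat.lt_succ_of_le hk, α, rfl⟩)
      refine provides_gradient (hV.trans Set.subset_union_left) (grp := grp) (σ := σ) (p := p)
        hp _ _ _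
        subset_rfl ?_
      refine .leaf fun j => ⟨_, Set.mem_union_right _ (Set.mem_range_self j), ?_⟩
      rintro ⟨D, x⟩ ⟨⟨rfl, hσ⟩, hp⟩
      simp only
      rw [D.idGrad_apply τ hσ, D.weight_eq_prefixCoef τ σ x (p := p) _ j, Rat.cast_ofNat]
      intro k hk
      rw [← hp k hk, blockMin]
      simp only [tailErr, tailSum, tailBlock, Rat.cast_natCast]
      rfl
  obtain ⟨P, hP⟩ := key.exists_tree
  refine ⟨P, fun D hD hσ x => ?_⟩
  obtain ⟨h₁, h₂⟩ := hP (D, x) ⟨hD, hσ⟩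
  refine ⟨congrFun h₁, h₂.trans ?_⟩
  -- With $n+1\le2n$ and $1\le|A|$ the phases cost at most $4+12+2+2+8=28$ times $n|A|$.
  nlinarith [Nat.mul_le_mul hn hA, Nat.mul_le_mul_left n hA, Nat.mul_le_mul_right (Fintype.card A) hn]

end FairData

theorem mainTheorem4 :
    -- iteration complexity
    (∀ (n : ℕ) (A : Type*) [Fintype A] [DecidableEq A] (D : FairData n A) (τ : TieBreak A),
      (∀ x, DifferentiableAt ℝ (D.idLoss τ) x → HasGradientAt (D.idLoss τ) (D.idGrad τ x) x) ∧
      (∀ θ : ℝ, 1 / 2 ≤ θ → θ < 1 → IsLojasiewiczExponent (D.idLoss τ) (D.idGrad τ) θ) ∧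
      ∃ η₀ : ℝ, 0 < η₀ ∧ ∀ η : ℝ, 0 < η → η ≤ η₀ →
        ∀ (x₀ : EuclideanSpace ℝ (Fin n)) (θ : ℝ), 0 ≤ θ → θ < 1 → θ ≠ 1 / 2 →
          ∃ C : ℝ, 0 < C ∧ ∀ ε : ℝ, 0 < ε →
            ∃ k : ℕ, (k : ℝ) ≤ C * ε ^ (-(2 / |1 - 2 * θ|)) ∧
              ‖D.idGrad τ (gradDescent (D.idGrad τ) η x₀ k)‖ ≤ ε) ∧
    -- cost of one gradient evaluation
    (∃ C : ℕ, ∀ (n : ℕ) (A : Type*) [Fintype A] [DecidableEq A] (τ : TieBreak A)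
      (grp : Fin n → A) (σ : Equiv.Perm (Fin n)),
      ∃ P : CompTree (Fin n ⊕ Fin n ⊕ Fin n) (Fin n),
        ∀ D : FairData n A, D.group = grp → Monotone (fun i => D.relevance (σ i)) →
          ∀ x : EuclideanSpace ℝ (Fin n),
            (∀ j, P.run (D.input x) (fun _ => 0) j = D.idGrad τ x j) ∧
            P.cost (D.input x) (fun _ => 0) ≤ C * (n * Fintype.card A)) := by
  refine ⟨fun n A _ _ D τ => ⟨D.hasGradientAt_idLoss τ,
    fun θ h₁ h₂ => D.isLojasiewiczExponent_idLoss τ h₁ h₂, 1 / 2, by norm_num,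
    fun η h0 h1 x₀ θ hθ0 hθ1 hθ => D.exists_gradDescent_norm_le τ h0 h1 x₀ ?_⟩,
    28, fun n A _ _ τ grp σ => FairData.exists_gradientTree τ grp σ⟩
  -- Since $0<|1-2\theta|\le1$, the exponent $2/|1-2\theta|$ is at least 2.
  have hpos : 0 < |1 - 2 * θ| := abs_pos.2 fun h => hθ (by linarith)
  have hle : |1 - 2 * θ| ≤ 1 := abs_le.2 ⟨by linarith, by linarith⟩
  rw [le_div_iff₀ hpos]
  linarith
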